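/- For a finite nonempty subset $M$ of a metric space $X$, let $\operatorname{mst}_X(M)$ be the least possible weight of a tree with vertex set $M$, where the weight of a tree is the sum of the distances in $X$ between the end-points of its edges. Put $\operatorname{smt}_X(M)=\inf_{N\supseteq M}\operatorname{mst}_X(N)$, where the infimum is taken over all finite subsets $N\subseteq X$ containing $M$. The \emph{Steiner ratio} of $X$ is $$\operatorname{sr}(X)=\inf_{M}\frac{\operatorname{smt}_X(M)}{\operatorname{mst}_X(M)},$$ where the infimum is taken over all finite subsets $M\subseteq X$ consisting of at least two points. An \emph{isosceles tetrahedron} (disphenoid) is a nondegenerate triangular pyramid in Euclidean $3$-space all of whose faces are pairwise congruent triangles. Its surface, the union of the four (closed, solid) faces, is equipped with the intrinsic metric: the distance between two points is the infimum of the lengths of the curves joining them within the surface. \textbf{Corollary.} The Steiner ratio of the surface of any isosceles tetrahedron, with its intrinsic metric, is equal to the Steiner ratio of the Euclidean plane $\mathbb{R}^2$. -/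

import Mathlib

open scoped ENNReal

noncomputable section

/-! ### Minimal spanning trees, shortest trees and the Steiner ratio -/

section Steiner

variable {X : Type*} [MetricSpace X]

open Classical in
/-- The weight of a graph whose vertex set is the finite set `M`: the sum of the distances between
the end-points of its edges. -/
def graphWeight (M : Finset X) (G : SimpleGraph M) : ℝ :=
  ∑ e ∈ G.edgeFinset, Sym2.lift ⟨fun x y : M => dist x y, fun x y => dist_comm x y⟩ e

/-- `mst M`: the least weight of a tree with vertex set `M`. -/
def mst (M : Finset X) : ℝ :=
  ⨅ T : {G : SimpleGraph M // G.IsTree}, graphWeight M T.1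

/-- `smt M`: the length of a shortest tree for `M`, i.e. the infimum of `mst N` over all finite
`N ⊇ M`. -/
def smt (M : Finset X) : ℝ :=
  ⨅ N : {N : Finset X // M ⊆ N}, mst N.1

variable (X) in
/-- The Steiner ratio of `X`: the infimum of `smt M / mst M` over all finite subsets `M` consisting
of at least two points. -/
def steinerRatio : ℝ :=
  ⨅ M : {M : Finset X // 2 ≤ M.card}, smt M.1 / mst M.1

end Steiner

/-! ### The intrinsic distance of a metric space -/

section Intrinsic

variable {X : Type*} [MetricSpace X]

/-- The length of a curve, i.e. the supremum of the lengths of inscribed polygons. -/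
def curveLength {x y : X} (γ : Path x y) : ℝ≥0∞ := eVariationOn γ Set.univ

/-- The infimum of the lengths of the curves joining `x` and `y`. -/
def intrinsicEDist (x y : X) : ℝ≥0∞ := ⨅ γ : Path x y, curveLength γ

lemma intrinsicEDist_self (x : X) : intrinsicEDist x x = 0 := by
  refine le_antisymm (iInf_le_of_le (Path.refl x) ?_) bot_le
  refine (eVariationOn.constant_on ?_).le
  rintro _ ⟨s, -, rfl⟩ _ ⟨t, -, rfl⟩
  rfl

lemma intrinsicEDist_le_symm (x y : X) : intrinsicEDist y x ≤ intrinsicEDist x y := by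
  refine le_iInf fun γ => iInf_le_of_le γ.symm ?_
  exact eVariationOn.comp_le_of_antitoneOn γ unitInterval.symm
    (fun a _ b _ h => unitInterval.symm_le_symm.2 h) (fun _ _ => trivial)

lemma intrinsicEDist_comm (x y : X) : intrinsicEDist x y = intrinsicEDist y x :=
  le_antisymm (intrinsicEDist_le_symm y x) (intrinsicEDist_le_symm x y)

lemma curveLength_trans_le {x y z : X} (γ : Path x y) (γ' : Path y z) :
    curveLength (γ.trans γ') ≤ curveLength γ + curveLength γ' := by
  let h : unitInterval := ⟨1 / 2, by norm_num, by norm_num⟩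
  have hu : (Set.univ : Set unitInterval) = Set.Iic h ∪ Set.Ici h := Set.Iic_union_Ici.symm
  have h1 : Set.EqOn (γ.trans γ')
      (γ ∘ fun t : unitInterval => Set.projIcc (0 : ℝ) 1 zero_le_one (2 * (t : ℝ)))
      (Set.Iic h) := by
    intro t ht
    have ht' : (t : ℝ) ≤ 1 / 2 := ht
    change (if (t : ℝ) ≤ 1 / 2 then γ.extend (2 * t) else γ'.extend (2 * t - 1)) = _
    rw [if_pos ht']
    rfl
  have h2 : Set.EqOn (γ.trans γ')
      (γ' ∘ fun t : unitInterval => Set.projIcc (0 : ℝ) 1 zero_le_one (2 * (t : ℝ) - 1))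
      (Set.Ici h) := by
    intro t ht
    have ht' : 1 / 2 ≤ (t : ℝ) := ht
    change (if (t : ℝ) ≤ 1 / 2 then γ.extend (2 * t) else γ'.extend (2 * t - 1)) = _
    split_ifs with h3
    · have h4 : (t : ℝ) = 1 / 2 := le_antisymm h3 ht'
      rw [show 2 * (t : ℝ) = 1 by rw [h4]; norm_num, γ.extend_one]
      simp only [Function.comp_apply, h4]
      norm_num
    · rfl
  unfold curveLength
  rw [hu, eVariationOn.union _ isGreatest_Iic isLeast_Ici, eVariationOn.congr h1,
    eVariationOn.congr h2]
  refine add_le_add ?_ ?_ <;> rw [← hu]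
  · refine eVariationOn.comp_le_of_monotoneOn γ _ (fun a _ b _ hab => ?_) (fun _ _ => trivial)
    exact Set.monotone_projIcc _ (mul_le_mul_of_nonneg_left hab zero_le_two)
  · refine eVariationOn.comp_le_of_monotoneOn γ' _ (fun a _ b _ hab => ?_) (fun _ _ => trivial)
    exact Set.monotone_projIcc _ (sub_le_sub_right
      (mul_le_mul_of_nonneg_left (show (a : ℝ) ≤ b from hab) zero_le_two) 1)

lemma intrinsicEDist_triangle (x y z : X) :
    intrinsicEDist x z ≤ intrinsicEDist x y + intrinsicEDist y z := by
  unfold intrinsicEDist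
  refine ENNReal.le_iInf_add_iInf fun γ γ' => ?_
  exact (iInf_le _ (γ.trans γ')).trans (curveLength_trans_le γ γ')

lemma edist_le_intrinsicEDist (x y : X) : edist x y ≤ intrinsicEDist x y := by
  refine le_iInf fun γ => ?_
  have := eVariationOn.edist_le γ (Set.mem_univ (0 : unitInterval)) (Set.mem_univ 1)
  rwa [γ.source, γ.target] at this

end Intrinsic

/-! ### The surface of a tetrahedron -/

/-- A nondegenerate tetrahedron (triangular pyramid) in Euclidean 3-space. -/
abbrev Tetrahedron := Affine.Simplex ℝ (EuclideanSpace ℝ (Fin 3)) 3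

namespace Tetrahedron

/-- A tetrahedron is isosceles (a disphenoid) if its faces are pairwise congruent triangles: for
any two faces there is a correspondence of their vertices that preserves the lengths of the
sides. -/
def IsIsosceles (s : Tetrahedron) : Prop :=
  ∀ i j : Fin 4, ∃ σ : Equiv.Perm (Fin 3),
    Congruent ((s.faceOpposite i).points ∘ σ) (s.faceOpposite j).points

/-- The face opposite to the vertex `i`: a closed solid triangle. -/
def triangle (s : Tetrahedron) (i : Fin 4) : Set (EuclideanSpace ℝ (Fin 3)) :=
  convexHull ℝ (Set.range (s.faceOpposite i).points)

/-- The surface of the tetrahedron: the union of its four faces. -/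
def surface (s : Tetrahedron) : Set (EuclideanSpace ℝ (Fin 3)) := ⋃ i, s.triangle i

lemma intrinsicEDist_ne_top_of_face (s : Tetrahedron) (i : Fin 4) (x y : s.surface)
    (hx : (x : EuclideanSpace ℝ (Fin 3)) ∈ s.triangle i)
    (hy : (y : EuclideanSpace ℝ (Fin 3)) ∈ s.triangle i) : intrinsicEDist x y ≠ ⊤ := by
  let f : unitInterval → EuclideanSpace ℝ (Fin 3) :=
    fun t => AffineMap.lineMap (x : EuclideanSpace ℝ (Fin 3)) (y : EuclideanSpace ℝ (Fin 3)) (t : ℝ)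
  have hf : LipschitzWith (nndist (x : EuclideanSpace ℝ (Fin 3)) y) f := by
    refine (lipschitzWith_lineMap _ _).comp (LipschitzWith.subtype_val _) |>.weaken ?_
    simp
  have hmem : ∀ t, f t ∈ s.surface := fun t =>
    Set.mem_iUnion.2 ⟨i, (convex_convexHull ℝ _).segment_subset hx hy
      (by rw [segment_eq_image_lineMap]; exact ⟨t, t.2, rfl⟩)⟩
  let γ : Path x y :=
    { toFun := fun t => ⟨f t, hmem t⟩
      continuous_toFun := hf.continuous.subtype_mk _
      source' := Subtype.ext (by simp [f])
      target' := Subtype.ext (by simp [f]) }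
  have hγ : LipschitzWith (nndist (x : EuclideanSpace ℝ (Fin 3)) y) γ := fun a b => hf a b
  refine ne_top_of_le_ne_top ?_ (iInf_le (fun γ : Path x y => curveLength γ) γ)
  have h1 := (hγ.lipschitzOnWith (s := Set.univ)).comp_eVariationOn_le
    (f := γ) (g := id) (s := Set.univ) (fun _ _ => trivial)
  refine ne_top_of_le_ne_top (ENNReal.mul_ne_top ENNReal.coe_ne_top ?_) h1
  have h2 : eVariationOn (id : unitInterval → unitInterval) Set.univ ≤ ENNReal.ofReal 1 := by
    have h3 : MonotoneOn (fun t : unitInterval => (t : ℝ)) Set.univ := fun _ _ _ _ h => h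
    have h4 := (h3.eVariationOn_eq (Set.mem_univ 0) (Set.mem_univ 1)).le
    have h5 : Set.univ ∩ Set.Icc (0 : unitInterval) 1 = Set.univ := by
      ext t; simp [unitInterval.le_one']
    rw [h5] at h4
    simpa using! h4
  exact ne_top_of_le_ne_top ENNReal.ofReal_ne_top h2

lemma intrinsicEDist_ne_top (s : Tetrahedron) (x y : s.surface) : intrinsicEDist x y ≠ ⊤ := by
  obtain ⟨i, hi⟩ := Set.mem_iUnion.1 x.2
  obtain ⟨j, hj⟩ := Set.mem_iUnion.1 y.2
  obtain ⟨k, hki, hkj⟩ : ∃ k : Fin 4, k ≠ i ∧ k ≠ j := by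
    clear hi hj
    revert i j
    decide
  have hv : ∀ l, k ≠ l → s.points k ∈ s.triangle l := fun l hl =>
    subset_convexHull ℝ _ (by rw [s.range_faceOpposite_points]; exact ⟨k, hl, rfl⟩)
  let z : s.surface := ⟨s.points k, Set.mem_iUnion.2 ⟨i, hv i hki⟩⟩
  exact ne_top_of_le_ne_top (ENNReal.add_ne_top.2
    ⟨s.intrinsicEDist_ne_top_of_face i x z hi (hv i hki),
      s.intrinsicEDist_ne_top_of_face j z y (hv j hkj) hj⟩) (intrinsicEDist_triangle x z y)

/-- The surface of the tetrahedron as a metric space of its own, carrying the intrinsic metric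
(and not the restriction of the metric of the ambient space). -/
structure Surface (s : Tetrahedron) where
  point : s.surface

/-- The intrinsic metric of the surface: the distance between two points is the infimum of the
lengths of the curves that join them within the surface. -/
instance (s : Tetrahedron) : MetricSpace s.Surface where
  dist x y := (intrinsicEDist x.point y.point).toReal
  dist_self x := by simp [intrinsicEDist_self]
  dist_comm x y := by rw [intrinsicEDist_comm]
  dist_triangle x y z := by
    rw [← ENNReal.toReal_add (s.intrinsicEDist_ne_top _ _) (s.intrinsicEDist_ne_top _ _)]
    exact ENNReal.toReal_mono
      (ENNReal.add_ne_top.2 ⟨s.intrinsicEDist_ne_top _ _, s.intrinsicEDist_ne_top _ _⟩)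
      (intrinsicEDist_triangle _ _ _)
  eq_of_dist_eq_zero := by
    rintro ⟨x⟩ ⟨y⟩ h
    have h0 : intrinsicEDist x y = 0 :=
      ((ENNReal.toReal_eq_zero_iff _).1 h).resolve_right (s.intrinsicEDist_ne_top _ _)
    have h1 : edist x y = 0 := le_antisymm (h0 ▸ edist_le_intrinsicEDist x y) bot_le
    rw [edist_eq_zero.1 h1]

end Tetrahedron

end

/-!
The surface of an isosceles tetrahedron is a quotient of the Euclidean plane by a group of
translations and half-turns: fold the plane along the lines of a triangular lattice whose triangles
are congruent to the faces. The folding `q` obtained in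
`Tetrahedron.IsIsosceles.exists_folding` has three properties, which together give the equality of
the Steiner ratios.

* It is isometric on a small disc. Every finite set in the plane has a similar copy in that disc,
  so the Steiner ratio of the surface is at most that of the plane
  (`steinerRatio_le_of_similar_copies`).
* It does not increase distances.
* For every `y` in the plane and every `x` on the surface there is a `y'` over `x` whose distance
  from `y` is at most the intrinsic distance from `q y` to `x`. Hence a tree on the surface lifts,
  edge by edge, to a tree in the plane that is no longer (`exists_lift_of_isTree`). Spanning trees
  on the surface are at most as long as those on the lifted vertices, so the Steiner ratio of the
  surface is at least that of the plane (`steinerRatio_le_of_submetry`).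

The folding is given by a formula. Opposite edges of the tetrahedron are equal, which makes the
three bimedians orthogonal, so that the tetrahedron is inscribed in a box: its vertices are
`O ± e₀ ± e₁ ± e₂` with an even number of minus signs. With `f` the triangle wave of period `2`, the
folding is `(t, u) ↦ O + f(t) e₀ + f(u) e₁ + f(t + u) e₂`, where the plane carries the norm
`2 √(‖e₀‖² t² + ‖e₁‖² u² + ‖e₂‖² (t + u)²)`. It does not increase distances, as `f` is
`2`-Lipschitz.

For the lifting property it is enough to lift within a single face (`exists_lift_face`): the
distance from `y` to the fibre of the folding over a point of the surface is then a function that is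
`1`-Lipschitz on each of the four closed faces, and along any curve such a function changes by at
most the length of the curve (`edist_le_eVariationOn_of_closed_cover`).
-/

noncomputable section

/-! ### Comparing Steiner ratios -/

section Comparison

variable {X Y : Type*} [MetricSpace X] [MetricSpace Y]

lemma graphWeight_nonneg (M : Finset X) (G : SimpleGraph M) : 0 ≤ graphWeight M G := by
  refine Finset.sum_nonneg fun e _ => ?_
  induction e with
  | _ x y => exact dist_nonneg

lemma mst_nonneg (M : Finset X) : 0 ≤ mst M := Real.iInf_nonneg fun T => graphWeight_nonneg M T.1

lemma smt_nonneg (M : Finset X) : 0 ≤ smt M := Real.iInf_nonneg fun N => mst_nonneg N.1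

lemma mst_le_graphWeight {M : Finset X} {T : SimpleGraph M} (hT : T.IsTree) :
    mst M ≤ graphWeight M T :=
  ciInf_le (f := fun T : {G : SimpleGraph M // G.IsTree} => graphWeight M T.1)
    ⟨0, by rintro _ ⟨T, rfl⟩; exact graphWeight_nonneg M T.1⟩ ⟨T, hT⟩

lemma smt_le_mst {M N : Finset X} (h : M ⊆ N) : smt M ≤ mst N :=
  ciInf_le (f := fun N : {N : Finset X // M ⊆ N} => mst N.1)
    ⟨0, by rintro _ ⟨N, rfl⟩; exact mst_nonneg N.1⟩ ⟨N, h⟩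

lemma steinerRatio_le {M : Finset X} (h : 2 ≤ M.card) : steinerRatio X ≤ smt M / mst M :=
  ciInf_le (f := fun M : {M : Finset X // 2 ≤ M.card} => smt M.1 / mst M.1)
    ⟨0, by rintro _ ⟨N, rfl⟩; exact div_nonneg (smt_nonneg _) (mst_nonneg _)⟩ ⟨M, h⟩

lemma exists_isTree_graphWeight_eq_mst {M : Finset X} (hM : M.Nonempty) :
    ∃ T : SimpleGraph M, T.IsTree ∧ graphWeight M T = mst M := by
  have : Nonempty M := hM.to_subtype
  obtain ⟨T₀, -, hT₀⟩ := (SimpleGraph.connected_top (V := M)).exists_isTree_le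
  have : Nonempty {G : SimpleGraph M // G.IsTree} := ⟨⟨T₀, hT₀⟩⟩
  obtain ⟨T, hT⟩ := exists_eq_ciInf_of_finite
    (f := fun T : {G : SimpleGraph M // G.IsTree} => graphWeight M T.1)
  exact ⟨T.1, T.2, hT⟩

lemma mst_pos {M : Finset X} (hM : 2 ≤ M.card) : 0 < mst M := by
  classical
  have hM' : M.Nonempty := Finset.card_pos.1 (by omega)
  obtain ⟨T, hT, hw⟩ := exists_isTree_graphWeight_eq_mst hM'
  have : Nontrivial M := Set.nontrivial_coe_sort.2 (Finset.one_lt_card_iff_nontrivial.1 hM)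
  obtain ⟨v⟩ := hM'.to_subtype
  obtain ⟨u, hu⟩ := hT.connected.preconnected.exists_adj_of_nontrivial v
  rw [← hw]
  refine Finset.sum_pos' (fun e _ => ?_) ⟨s(v, u), ?_, ?_⟩
  · induction e with
    | _ x y => exact dist_nonneg
  · rwa [SimpleGraph.mem_edgeFinset]
  · exact dist_pos.2 fun h => hu.ne (Subtype.ext h)

/-- A tree can be carried over along a bijection of the vertex sets; only the distances along its
edges matter. -/
lemma mst_le_mul_graphWeight {M : Finset X} {N : Finset Y} (e : M ≃ N) {k : ℝ}
    {T : SimpleGraph M} (hT : T.IsTree)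
    (h : ∀ x y : M, T.Adj x y → dist (e x : Y) (e y) ≤ k * dist (x : X) y) :
    mst N ≤ k * graphWeight M T := by
  classical
  let i := SimpleGraph.Iso.map e T
  refine (mst_le_graphWeight (i.isTree_iff.1 hT)).trans ?_
  unfold graphWeight
  rw [Finset.mul_sum]
  have hsum : ∑ x ∈ (T.map e).edgeFinset,
      Sym2.lift ⟨fun x y : N => dist x y, fun x y => dist_comm x y⟩ x =
      ∑ x ∈ T.edgeFinset,
        Sym2.lift ⟨fun x y : N => dist x y, fun x y => dist_comm x y⟩ (x.map e) := by
    symm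
    refine Finset.sum_bij (fun x _ => x.map e) ?_ ?_ ?_ ?_
    · intro x hx
      rw [SimpleGraph.mem_edgeFinset] at hx ⊢
      induction x with
      | _ x y => exact i.map_adj_iff.2 hx
    · intro x _ y _ hxy
      exact Sym2.map.injective e.injective hxy
    · intro x hx
      refine ⟨x.map e.symm, ?_, by simp [Sym2.map_map]⟩
      rw [SimpleGraph.mem_edgeFinset] at hx ⊢
      induction x with
      | _ x y => exact i.symm.map_adj_iff.2 hx
    · intro _ _
      rfl
  have hle : ∀ x ∈ T.edgeFinset,
      Sym2.lift ⟨fun x y : N => dist x y, fun x y => dist_comm x y⟩ (x.map e) ≤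
        k * Sym2.lift ⟨fun x y : M => dist x y, fun x y => dist_comm x y⟩ x := by
    intro x hx
    rw [SimpleGraph.mem_edgeFinset] at hx
    induction x with
    | _ x y => exact h x y hx
  convert hsum.le.trans (Finset.sum_le_sum hle)

lemma mst_le_mul_mst {M : Finset X} {N : Finset Y} (hM : M.Nonempty) (e : M ≃ N) {k : ℝ}
    (h : ∀ x y : M, dist (e x : Y) (e y) ≤ k * dist (x : X) y) :
    mst N ≤ k * mst M := by
  obtain ⟨T, hT, hw⟩ := exists_isTree_graphWeight_eq_mst hM
  rw [← hw]
  exact mst_le_mul_graphWeight e hT fun x y _ => h x y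

/-- The restriction of an injective map to a finite set, as a bijection onto the image. -/
def Finset.equivImage [DecidableEq Y] (f : X → Y) (M : Finset X) (hf : Set.InjOn f M) :
    M ≃ M.image f :=
  Equiv.ofBijective (fun x => ⟨f x, Finset.mem_image_of_mem f x.2⟩)
    ⟨fun x y hxy => Subtype.ext (hf x.2 y.2 (congrArg Subtype.val hxy)), by
      rintro ⟨_, hy⟩
      obtain ⟨x, hx, rfl⟩ := Finset.mem_image.1 hy
      exact ⟨⟨x, hx⟩, rfl⟩⟩

/-- If every finite subset of `Y` has a similar copy in `X`, then the Steiner ratio of `X` is at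
most that of `Y`. -/
theorem steinerRatio_le_of_similar_copies [Nontrivial Y]
    (h : ∀ N : Finset Y, ∃ ψ : Y → X, ∃ r : ℝ, 0 < r ∧
      ∀ x ∈ N, ∀ y ∈ N, dist (ψ x) (ψ y) = r * dist x y) :
    steinerRatio X ≤ steinerRatio Y := by
  classical
  obtain ⟨a, b, hab⟩ := exists_pair_ne Y
  have : Nonempty {M : Finset Y // 2 ≤ M.card} := ⟨⟨{a, b}, (Finset.card_pair hab).ge⟩⟩
  refine le_ciInf fun ⟨M, hM⟩ => ?_
  have hM0 : M.Nonempty := Finset.card_pos.1 (by omega)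
  have hpos := mst_pos hM
  rw [le_div_iff₀ hpos]
  have : Nonempty {N : Finset Y // M ⊆ N} := ⟨⟨M, subset_rfl⟩⟩
  refine le_ciInf fun ⟨N, hMN⟩ => ?_
  obtain ⟨ψ, r, hr, hψ⟩ := h N
  have hinj : Set.InjOn ψ N := fun x hx y hy hxy => by
    have := hψ x hx y hy
    rw [hxy, dist_self] at this
    exact dist_eq_zero.1 ((mul_eq_zero.1 this.symm).resolve_left hr.ne')
  have hN : mst (N.image ψ) ≤ r * mst N :=
    mst_le_mul_mst (hM0.mono hMN) (Finset.equivImage ψ N hinj)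
      fun x y => (hψ x x.2 y y.2).le
  have hinjM : Set.InjOn ψ M := hinj.mono hMN
  let e := Finset.equivImage ψ M hinjM
  have hM' : mst M ≤ r⁻¹ * mst (M.image ψ) := by
    refine mst_le_mul_mst (hM0.image ψ) e.symm fun x y => ?_
    obtain ⟨x, rfl⟩ := e.surjective x
    obtain ⟨y, rfl⟩ := e.surjective y
    rw [e.symm_apply_apply, e.symm_apply_apply]
    change _ ≤ r⁻¹ * dist (ψ x) (ψ y)
    rw [hψ x (hMN x.2) y (hMN y.2), inv_mul_cancel_left₀ hr.ne']
  rw [← div_eq_inv_mul, le_div_iff₀ hr] at hM'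
  have hc : 2 ≤ (M.image ψ).card := by rwa [Finset.card_image_of_injOn hinjM]
  have h1 : steinerRatio X * mst (M.image ψ) ≤ r * mst N :=
    ((le_div_iff₀ (mst_pos hc)).1 (steinerRatio_le hc)).trans
      ((smt_le_mst (Finset.image_subset_image hMN)).trans hN)
  have h0 : 0 ≤ steinerRatio X :=
    Real.iInf_nonneg fun M => div_nonneg (smt_nonneg _) (mst_nonneg _)
  refine le_of_mul_le_mul_left ?_ hr
  calc r * (steinerRatio X * mst M) = steinerRatio X * (mst M * r) := by ring
    _ ≤ steinerRatio X * mst (M.image ψ) := mul_le_mul_of_nonneg_left hM' h0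
    _ ≤ r * mst N := h1

/-- Trees lift through `p` edge by edge: beginning at a root, every vertex is given a lift that
is no farther from the lift of its parent than the vertex is from the parent. -/
lemma exists_lift_of_isTree {V : Type*} {T : SimpleGraph V} (hT : T.IsTree) {p : Y → X}
    (hp : ∀ (y : Y) (x : X), ∃ y', p y' = x ∧ dist y y' ≤ dist (p y) x) (y₀ : Y) (f : V → X) :
    ∃ g : V → Y, (∀ v, p (g v) = f v) ∧
      ∀ v w, T.Adj v w → dist (g v) (g w) ≤ dist (f v) (f w) := by
  obtain ⟨r⟩ := hT.connected.nonempty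
  have hparent : ∀ v, v ≠ r → ∃ w, T.Adj v w ∧ T.dist r w < T.dist r v := by
    intro v hv
    obtain ⟨q, hq⟩ := (hT.connected v r).exists_walk_length_eq_dist
    cases q with
    | nil => exact absurd rfl hv
    | cons hadj q =>
      refine ⟨_, hadj, ?_⟩
      rw [SimpleGraph.dist_comm, SimpleGraph.dist_comm (u := r), ← hq,
        SimpleGraph.Walk.length_cons]
      exact Nat.lt_succ_of_le (SimpleGraph.dist_le q)
  choose! π hπ hlt using hparent
  choose l hl hl' using hp
  classical
  have hrec : ∃ g : V → Y, ∀ v, g v = if v = r then l y₀ (f r) else l (g (π v)) (f v) := by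
    let F : ∀ v, (∀ w, T.dist r w < T.dist r v → Y) → Y := fun v ih =>
      if h : v = r then l y₀ (f r) else l (ih (π v) (hlt v h)) (f v)
    let wf : WellFounded fun w v => T.dist r w < T.dist r v :=
      InvImage.wf (T.dist r) wellFounded_lt
    refine ⟨wf.fix F, fun v => ?_⟩
    rw [wf.fix_eq]
    rfl
  obtain ⟨g, hg⟩ := hrec
  have hpg : ∀ v, p (g v) = f v := by
    intro v
    rw [hg]
    split_ifs with h
    · rw [hl, h]
    · rw [hl]
  refine ⟨g, hpg, ?_⟩
  -- The edges from vertices to their parents form a connected graph, hence they are all the edges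
  -- of the tree.
  let P : SimpleGraph V := SimpleGraph.fromRel fun v w => v ≠ r ∧ w = π v
  have hPT : P ≤ T := by
    rintro v w ⟨-, ⟨h, rfl⟩ | ⟨h, rfl⟩⟩
    · exact hπ v h
    · exact (hπ w h).symm
  have hreach : ∀ n v, T.dist r v = n → P.Reachable v r := by
    intro n
    induction n using Nat.strong_induction_on with
    | _ n ih =>
      intro v hn
      by_cases h : v = r
      · rw [h]
      · have hadj : P.Adj v (π v) := ⟨(hπ v h).ne, Or.inl ⟨h, rfl⟩⟩
        exact hadj.reachable.trans (ih _ (hn ▸ hlt v h) _ rfl)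
  have hP : P.Connected :=
    { preconnected := fun v w => (hreach _ v rfl).trans (hreach _ w rfl).symm
      nonempty := ⟨r⟩ }
  have hTP : T ≤ P := (SimpleGraph.isTree_iff_minimal_connected.1 hT).2 hP hPT
  have hstep : ∀ v, v ≠ r → dist (g (π v)) (g v) ≤ dist (f (π v)) (f v) := by
    intro v h
    rw [hg v, if_neg h, ← hpg (π v)]
    exact hl' _ _
  intro v w hvw
  obtain ⟨-, ⟨h, rfl⟩ | ⟨h, rfl⟩⟩ := hTP hvw
  · rw [dist_comm (g v), dist_comm (f v)]
    exact hstep v h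
  · exact hstep w h

/-- A map that does not increase distances, and along which points can be lifted without increasing
distances either, does not lower the Steiner ratio. -/
theorem steinerRatio_le_of_submetry [Nontrivial X] [Nonempty Y] (p : Y → X)
    (hp : ∀ x y, dist (p x) (p y) ≤ dist x y)
    (hlift : ∀ (y : Y) (x : X), ∃ y', p y' = x ∧ dist y y' ≤ dist (p y) x) :
    steinerRatio Y ≤ steinerRatio X := by
  classical
  obtain ⟨a, b, hab⟩ := exists_pair_ne X
  have : Nonempty {M : Finset X // 2 ≤ M.card} := ⟨⟨{a, b}, (Finset.card_pair hab).ge⟩⟩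
  refine le_ciInf fun ⟨M, hM⟩ => ?_
  have hM0 : M.Nonempty := Finset.card_pos.1 (by omega)
  rw [le_div_iff₀ (mst_pos hM)]
  have : Nonempty {N : Finset X // M ⊆ N} := ⟨⟨M, subset_rfl⟩⟩
  refine le_ciInf fun ⟨N, hMN⟩ => ?_
  obtain ⟨T, hT, hw⟩ := exists_isTree_graphWeight_eq_mst (hM0.mono hMN)
  obtain ⟨y₀⟩ := ‹Nonempty Y›
  obtain ⟨g, hpg, hg⟩ := exists_lift_of_isTree hT hlift y₀ Subtype.val
  let σ : X → Y := fun x => if hx : x ∈ N then g ⟨x, hx⟩ else y₀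
  have hσ : ∀ x : N, σ x = g x := fun x => dif_pos x.2
  have hpσ : ∀ x ∈ N, p (σ x) = x := fun x hx => by rw [hσ ⟨x, hx⟩, hpg]
  have hinj : Set.InjOn σ N := fun x hx y hy hxy => by
    rw [← hpσ x hx, ← hpσ y hy, hxy]
  have hinjM : Set.InjOn σ M := hinj.mono hMN
  have hN : mst (N.image σ) ≤ 1 * graphWeight N T := by
    refine mst_le_mul_graphWeight (Finset.equivImage σ N hinj) hT fun x y hxy => ?_
    change dist (σ x) (σ y) ≤ _
    rw [hσ, hσ, one_mul]
    exact hg x y hxy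
  let e := Finset.equivImage σ M hinjM
  have hM' : mst M ≤ 1 * mst (M.image σ) := by
    refine mst_le_mul_mst (hM0.image σ) e.symm fun x y => ?_
    obtain ⟨x, rfl⟩ := e.surjective x
    obtain ⟨y, rfl⟩ := e.surjective y
    rw [e.symm_apply_apply, e.symm_apply_apply, one_mul]
    change dist (x : X) y ≤ dist (σ x) (σ y)
    calc dist (x : X) y = dist (p (σ x)) (p (σ y)) := by
          rw [hpσ x (hMN x.2), hpσ y (hMN y.2)]
      _ ≤ _ := hp _ _
  rw [one_mul] at hN hM'
  have hc : 2 ≤ (M.image σ).card := by rwa [Finset.card_image_of_injOn hinjM]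
  have h0 : 0 ≤ steinerRatio Y :=
    Real.iInf_nonneg fun M => div_nonneg (smt_nonneg _) (mst_nonneg _)
  calc steinerRatio Y * mst M ≤ steinerRatio Y * mst (M.image σ) :=
        mul_le_mul_of_nonneg_left hM' h0
    _ ≤ smt (M.image σ) := (le_div_iff₀ (mst_pos hc)).1 (steinerRatio_le hc)
    _ ≤ mst (N.image σ) := smt_le_mst (Finset.image_subset_image hMN)
    _ ≤ graphWeight N T := hN
    _ = mst N := hw

end Comparison

/-! ### Lengths of curves -/

section Length

variable {X : Type*} [MetricSpace X]

/-- If a curve is covered by finitely many closed sets on each of which `g` is `1`-Lipschitz, then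
`g` changes along the curve by at most its length. No curve has to be cut into infinitely many
pieces: the part between the first point of the curve and its last point in a closed set containing
the first point is dealt with by the Lipschitz property there, and the rest is covered by one set
less. -/
lemma edist_le_eVariationOn_of_closed_cover {ι : Type*} {C : ι → Set X}
    (hC : ∀ i, IsClosed (C i)) {g : X → ℝ} (hg : ∀ i, LipschitzOnWith 1 g (C i))
    {γ : unitInterval → X} (hγ : Continuous γ) (S : Finset ι) {a b : unitInterval} (hab : a ≤ b)
    (hS : ∀ t ∈ Set.Icc a b, ∃ i ∈ S, γ t ∈ C i) :
    edist (g (γ a)) (g (γ b)) ≤ eVariationOn γ (Set.Icc a b) := by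
  classical
  induction S using Finset.strongInduction generalizing a with
  | H S ih =>
    obtain ⟨i, hi, hai⟩ := hS a ⟨le_rfl, hab⟩
    have hcpt : IsCompact (Set.Icc a b ∩ γ ⁻¹' C i) :=
      isCompact_Icc.inter_right ((hC i).preimage hγ)
    obtain ⟨t, ⟨⟨hat, htb⟩, hti⟩, hmax⟩ := hcpt.exists_isGreatest ⟨a, ⟨le_rfl, hab⟩, hai⟩
    have h1 : edist (g (γ a)) (g (γ t)) ≤ eVariationOn γ (Set.Icc a t) := by
      refine (hg i hai hti).trans ?_
      rw [ENNReal.coe_one, one_mul]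
      exact eVariationOn.edist_le γ ⟨le_rfl, hat⟩ ⟨hat, le_rfl⟩
    rcases htb.eq_or_lt with rfl | htb'
    · exact h1
    have hcover : ∀ u ∈ Set.Icc t b, u ∈ ⋃ j ∈ S.erase i, γ ⁻¹' C j := by
      have hcl : IsClosed (⋃ j ∈ S.erase i, γ ⁻¹' C j) :=
        (S.erase i).finite_toSet.isClosed_biUnion fun j _ => (hC j).preimage hγ
      have hsub : Set.Ioc t b ⊆ ⋃ j ∈ S.erase i, γ ⁻¹' C j := by
        intro u hu
        obtain ⟨j, hj, huj⟩ := hS u ⟨hat.trans hu.1.le, hu.2⟩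
        have hji : j ≠ i := by
          rintro rfl
          exact hu.1.not_ge (hmax ⟨⟨hat.trans hu.1.le, hu.2⟩, huj⟩)
        exact Set.mem_biUnion (Finset.mem_erase.2 ⟨hji, hj⟩) huj
      rw [← closure_Ioc htb'.ne]
      exact fun u hu => closure_minimal hsub hcl hu
    have h2 : edist (g (γ t)) (g (γ b)) ≤ eVariationOn γ (Set.Icc t b) := by
      refine ih (S.erase i) (Finset.erase_ssubset hi) htb fun u hu => ?_
      simpa using hcover u hu
    have h3 := eVariationOn.Icc_add_Icc γ hat htb (Set.mem_univ t)
    simp only [Set.univ_inter] at h3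
    rw [← h3]
    exact (edist_triangle _ (g (γ t)) _).trans (add_le_add h1 h2)

/-- A map `p` that lifts points without increasing distances within each of finitely many closed
sets covering `X` lifts points without increasing intrinsic distances. The function to which
`edist_le_eVariationOn_of_closed_cover` is applied is the distance from `y` to the fibre of `p`. -/
lemma exists_lift_of_lift_on_closed_cover {Y : Type*} [MetricSpace Y] [ProperSpace Y]
    {ι : Type*} [Finite ι] {C : ι → Set X} (hC : ∀ i, IsClosed (C i)) (hcover : ∀ x, ∃ i, x ∈ C i)
    {p : Y → X} (hp : Continuous p) (hsurj : Function.Surjective p)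
    (hlift : ∀ i y x, p y ∈ C i → x ∈ C i → ∃ y', p y' = x ∧ dist y y' ≤ dist (p y) x)
    (y : Y) (x : X) :
    ∃ y', p y' = x ∧ ENNReal.ofReal (dist y y') ≤ intrinsicEDist (p y) x := by
  classical
  have := Fintype.ofFinite ι
  have hne : ∀ z, (p ⁻¹' {z}).Nonempty := fun z => hsurj z
  have hcl : ∀ z, IsClosed (p ⁻¹' {z}) := fun z => isClosed_singleton.preimage hp
  let g : X → ℝ := fun z => Metric.infDist y (p ⁻¹' {z})
  have hg : ∀ i, LipschitzOnWith 1 g (C i) := by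
    refine fun i => LipschitzOnWith.of_le_add fun z hz w hw => ?_
    obtain ⟨w', hw', hd⟩ := (hcl w).exists_infDist_eq_dist (hne w) y
    obtain rfl : p w' = w := hw'
    obtain ⟨z', hz', hd'⟩ := hlift i w' z hw hz
    calc g z ≤ dist y z' := Metric.infDist_le_dist_of_mem hz'
      _ ≤ dist y w' + dist w' z' := dist_triangle _ _ _
      _ ≤ g (p w') + dist z (p w') := by
        rw [dist_comm z]
        exact add_le_add hd.ge hd'
  obtain ⟨y', hy', hd⟩ := (hcl x).exists_infDist_eq_dist (hne x) y
  refine ⟨y', hy', le_iInf fun γ => ?_⟩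
  have h := edist_le_eVariationOn_of_closed_cover hC hg γ.continuous Finset.univ zero_le_one
    fun t _ => by simpa using hcover (γ t)
  have h0 : g (p y) = 0 := Metric.infDist_zero_of_mem rfl
  rw [γ.source, γ.target, h0, edist_comm, edist_dist, Real.dist_eq, sub_zero,
    abs_of_nonneg Metric.infDist_nonneg] at h
  change ENNReal.ofReal (Metric.infDist y (p ⁻¹' {x})) ≤ _ at h
  rw [hd] at h
  exact h.trans (eVariationOn.mono _ (Set.subset_univ _))

/-- The image of a segment under a `1`-Lipschitz map is a curve no longer than the segment. -/
lemma intrinsicEDist_le_of_lipschitzWith {E : Type*} [NormedAddCommGroup E] [NormedSpace ℝ E]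
    {p : E → X} (hp : LipschitzWith 1 p) (x y : E) :
    intrinsicEDist (p x) (p y) ≤ ENNReal.ofReal (dist x y) := by
  have hl : LipschitzWith (nndist x y)
      fun t : unitInterval => p (AffineMap.lineMap x y (t : ℝ)) := by
    refine (hp.comp ((lipschitzWith_lineMap x y).comp (LipschitzWith.subtype_val _))).weaken ?_
    simp
  let γ : Path (p x) (p y) :=
    { toFun := fun t => p (AffineMap.lineMap x y (t : ℝ))
      continuous_toFun := hl.continuous
      source' := by simp
      target' := by simp }
  refine (iInf_le (fun γ : Path (p x) (p y) => curveLength γ) γ).trans ?_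
  have h1 := (hl.lipschitzOnWith (s := Set.univ)).comp_eVariationOn_le
    (g := id) (s := Set.univ) (fun _ _ => trivial)
  have h2 : eVariationOn (id : unitInterval → unitInterval) Set.univ ≤ 1 := by
    have h3 : MonotoneOn (fun t : unitInterval => (t : ℝ)) Set.univ := fun _ _ _ _ h => h
    have h4 := (h3.eVariationOn_eq (Set.mem_univ 0) (Set.mem_univ 1)).le
    have h5 : Set.univ ∩ Set.Icc (0 : unitInterval) 1 = Set.univ := by
      ext t; simp [unitInterval.le_one']
    rw [h5] at h4
    simpa using! h4
  refine (h1.trans (mul_le_mul_right h2 _)).trans ?_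
  rw [mul_one, ← edist_dist, edist_nndist]

end Length

/-! ### The triangle wave -/

/-- The triangle wave of period `2` that falls linearly from `1` at `0` to `-1` at `1`. -/
def triangleWave (x : ℝ) : ℝ := 1 - 2 * ‖(x : AddCircle (2 : ℝ))‖

lemma triangleWave_of_abs_le {x : ℝ} (hx : |x| ≤ 1) : triangleWave x = 1 - 2 * |x| := by
  rw [triangleWave, (AddCircle.norm_coe_eq_abs_iff 2 two_ne_zero).2 (by simpa using hx)]

lemma triangleWave_neg (x : ℝ) : triangleWave (-x) = triangleWave x := by
  rw [triangleWave, triangleWave, AddCircle.coe_neg, norm_neg]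

lemma triangleWave_add_two_mul (x : ℝ) (n : ℤ) : triangleWave (x + 2 * n) = triangleWave x := by
  have h : ((x + 2 * n : ℝ) : AddCircle (2 : ℝ)) = x := by
    rw [AddCircle.coe_add, mul_comm, ← zsmul_eq_mul, AddCircle.coe_zsmul, AddCircle.coe_period,
      smul_zero, add_zero]
  rw [triangleWave, triangleWave, h]

lemma triangleWave_of_one_le_abs {x : ℝ} (h₁ : 1 ≤ |x|) (h₂ : |x| ≤ 2) :
    triangleWave x = 2 * |x| - 3 := by
  rcases abs_cases x with ⟨h, h'⟩ | ⟨h, h'⟩ <;> rw [h] at h₁ h₂ ⊢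
  · rw [← triangleWave_add_two_mul x (-1), triangleWave_of_abs_le, abs_of_nonpos]
    · push_cast; ring
    · push_cast; linarith
    · push_cast; rw [abs_le]; constructor <;> linarith
  · rw [← triangleWave_add_two_mul x 1, triangleWave_of_abs_le, abs_of_nonneg]
    · push_cast; ring
    · push_cast; linarith
    · push_cast; rw [abs_le]; constructor <;> linarith

lemma abs_triangleWave_sub_le (x y : ℝ) :
    |triangleWave x - triangleWave y| ≤ 2 * |x - y| := by
  have h1 := abs_norm_sub_norm_le (x : AddCircle (2 : ℝ)) y
  have h2 : ‖(x : AddCircle (2 : ℝ)) - y‖ ≤ |x - y| := by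
    rw [← AddCircle.coe_sub]
    exact QuotientAddGroup.norm_mk_le_norm
  rw [triangleWave, triangleWave, abs_le] at *
  constructor <;> linarith [h1.1, h1.2]

lemma exists_eq_add_two_mul (x : ℝ) : ∃ (y : ℝ) (n : ℤ), |y| ≤ 1 ∧ x = y + 2 * n := by
  refine ⟨x - 2 * round (x / 2), round (x / 2), ?_, by ring⟩
  have h := abs_sub_round (x / 2)
  rw [abs_le] at h ⊢
  constructor <;> linarith [h.1, h.2]

lemma abs_triangleWave_le_one (x : ℝ) : |triangleWave x| ≤ 1 := by
  obtain ⟨y, n, hy, rfl⟩ := exists_eq_add_two_mul x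
  rw [triangleWave_add_two_mul, triangleWave_of_abs_le hy, abs_le]
  constructor <;> linarith [abs_nonneg y]

lemma triangleWave_add_one (x : ℝ) : triangleWave (x + 1) = -triangleWave x := by
  obtain ⟨y, n, hy, rfl⟩ := exists_eq_add_two_mul x
  rw [add_right_comm, triangleWave_add_two_mul, triangleWave_add_two_mul,
    triangleWave_of_abs_le hy]
  rw [abs_le] at hy
  rcases le_total y 0 with h | h
  · rw [triangleWave_of_abs_le (by rw [abs_le]; constructor <;> linarith), abs_of_nonpos h,
      abs_of_nonneg (by linarith)]
    ring
  · rw [show y + 1 = y - 1 + 2 * (1 : ℤ) by push_cast; ring, triangleWave_add_two_mul,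
      triangleWave_of_abs_le (by rw [abs_le]; constructor <;> linarith), abs_of_nonneg h,
      abs_of_nonpos (by linarith)]
    ring

/-! ### Folding the plane -/

/-- The barycentric coordinate, up to the factor `1 / 4`, of the point `(X, Y, Z)` at the `i`-th
vertex of the tetrahedron with vertices `(1, 1, 1)`, `(1, -1, -1)`, `(-1, 1, -1)`, `(-1, -1, 1)`. -/
def vertexWeight (X Y Z : ℝ) : Fin 4 → ℝ :=
  ![1 + X + Y + Z, 1 + X - Y - Z, 1 - X + Y - Z, 1 - X - Y + Z]

/-- The folding `(t, u) ↦ (f t, f u, f (t + u))`, with `f` the triangle wave, maps the plane to the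
surface of the tetrahedron with vertices `(1, 1, 1)`, `(1, -1, -1)`, `(-1, 1, -1)`,
`(-1, -1, 1)`. -/
lemma exists_vertexWeight_triangleWave_eq_zero (t u : ℝ) :
    ∃ i, vertexWeight (triangleWave t) (triangleWave u) (triangleWave (t + u)) i = 0 ∧
      ∀ j, 0 ≤ vertexWeight (triangleWave t) (triangleWave u) (triangleWave (t + u)) j := by
  obtain ⟨t, n, ht, rfl⟩ := exists_eq_add_two_mul t
  obtain ⟨u, m, hu, rfl⟩ := exists_eq_add_two_mul u
  have h1 := abs_le.1 (abs_triangleWave_le_one t)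
  have h2 := abs_le.1 (abs_triangleWave_le_one u)
  have h3 := abs_le.1 (abs_triangleWave_le_one (t + u))
  rw [show t + 2 * n + (u + 2 * m) = t + u + 2 * ((n + m : ℤ) : ℝ) by push_cast; ring,
    triangleWave_add_two_mul, triangleWave_add_two_mul, triangleWave_add_two_mul]
  have hT := triangleWave_of_abs_le ht
  have hU := triangleWave_of_abs_le hu
  generalize triangleWave t = X at *
  generalize triangleWave u = Y at *
  suffices h : 1 + X + Y + triangleWave (t + u) = 0 ∨ 1 + X - Y - triangleWave (t + u) = 0 ∨
      1 - X + Y - triangleWave (t + u) = 0 ∨ 1 - X - Y + triangleWave (t + u) = 0 by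
    generalize triangleWave (t + u) = Z at *
    rcases h with h | h | h | h
    · refine ⟨0, h, fun j => ?_⟩
      fin_cases j <;> simp [vertexWeight] <;> linarith
    · refine ⟨1, h, fun j => ?_⟩
      fin_cases j <;> simp [vertexWeight] <;> linarith
    · refine ⟨2, h, fun j => ?_⟩
      fin_cases j <;> simp [vertexWeight] <;> linarith
    · refine ⟨3, h, fun j => ?_⟩
      fin_cases j <;> simp [vertexWeight] <;> linarith
  clear h1 h2 h3
  rcases le_or_gt 1 |t + u| with h | h
  · left
    have hle := abs_add_le t u
    rw [triangleWave_of_one_le_abs h (by linarith), hT, hU]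
    rcases abs_cases t with ⟨h4, _⟩ | ⟨h4, _⟩ <;> rcases abs_cases u with ⟨h5, _⟩ | ⟨h5, _⟩ <;>
      rcases abs_cases (t + u) with ⟨h6, _⟩ | ⟨h6, _⟩ <;> rw [h4] at ht ⊢ <;> rw [h5] at hu ⊢ <;>
      rw [h6] at h ⊢ <;> linarith
  rw [triangleWave_of_abs_le h.le]
  rcases abs_cases t with ⟨h4, _⟩ | ⟨h4, _⟩ <;> rcases abs_cases u with ⟨h5, _⟩ | ⟨h5, _⟩ <;>
    rcases abs_cases (t + u) with ⟨h6, _⟩ | ⟨h6, _⟩ <;> rw [h4] at hT <;> rw [h5] at hU <;>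
    rw [h6]
  · right; right; right; linarith
  · right; right; right; linarith
  · right; left; linarith
  · right; right; left; linarith
  · right; right; left; linarith
  · right; left; linarith
  · right; right; right; linarith
  · right; right; right; linarith

lemma exists_vertexWeight_triangleWave_eq_zero_of_face (i : Fin 4) :
    ∃ t u, vertexWeight (triangleWave t) (triangleWave u) (triangleWave (t + u)) i = 0 ∧
      ∀ j, 0 ≤ vertexWeight (triangleWave t) (triangleWave u) (triangleWave (t + u)) j := by
  have h0 : triangleWave 0 = 1 := by rw [triangleWave_of_abs_le] <;> norm_num
  have h1 : triangleWave 1 = -1 := by rw [triangleWave_of_abs_le] <;> norm_num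
  rcases eq_or_ne i 0 with rfl | hi
  · refine ⟨1, 0, ?_, fun j => ?_⟩
    · simp [vertexWeight, h0, h1]
    · fin_cases j <;> norm_num [vertexWeight, h0, h1]
  · refine ⟨0, 0, ?_, fun j => ?_⟩
    · fin_cases i <;> simp [vertexWeight, h0] at hi ⊢
    · fin_cases j <;> norm_num [vertexWeight, h0]

/-- Up to a period, the folding takes the value `(f t, f u, f (t + u))` in the plane of the last
face only on the two triangles around the origin that lie opposite to each other. -/
lemma exists_lift_last_face {t u X Y Z : ℝ}
    (h : vertexWeight (triangleWave t) (triangleWave u) (triangleWave (t + u)) 3 = 0)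
    (h₀ : vertexWeight X Y Z 3 = 0) (hnn : ∀ j, 0 ≤ vertexWeight X Y Z j) :
    ∃ t' u', triangleWave t' = X ∧ triangleWave u' = Y ∧ triangleWave (t' + u') = Z ∧
      4 * (t - t') ^ 2 = (triangleWave t - X) ^ 2 ∧ 4 * (u - u') ^ 2 = (triangleWave u - Y) ^ 2 ∧
      4 * (t + u - (t' + u')) ^ 2 = (triangleWave (t + u) - Z) ^ 2 := by
  obtain ⟨t, n, ht, rfl⟩ := exists_eq_add_two_mul t
  obtain ⟨u, m, hu, rfl⟩ := exists_eq_add_two_mul u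
  have hs : ∀ x y : ℝ, x + 2 * n + (y + 2 * m) = x + y + 2 * ((n + m : ℤ) : ℝ) := by
    intro x y
    push_cast
    ring
  rw [hs, triangleWave_add_two_mul, triangleWave_add_two_mul, triangleWave_add_two_mul] at *
  have hT := triangleWave_of_abs_le ht
  have hU := triangleWave_of_abs_le hu
  have hX : X ≤ 1 := by have := hnn 2; simp [vertexWeight] at *; linarith
  have hY : Y ≤ 1 := by have := hnn 1; simp [vertexWeight] at *; linarith
  have hZ : -1 ≤ Z := by have := hnn 0; simp [vertexWeight] at *; linarith
  have hXYZ : X + Y - Z = 1 := by simp [vertexWeight] at *; linarith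
  have h' : triangleWave t + triangleWave u - triangleWave (t + u) = 1 := by
    simp [vertexWeight] at h; linarith
  have hcases : (0 ≤ t ∧ 0 ≤ u ∧ t + u ≤ 1) ∨ (t ≤ 0 ∧ u ≤ 0 ∧ -1 ≤ t + u) := by
    have hle := abs_add_le t u
    have h1 : |t + u| ≤ 1 := by
      by_contra! h1
      rw [triangleWave_of_one_le_abs h1.le (by linarith)] at h'
      linarith
    rw [triangleWave_of_abs_le h1, hT, hU] at h'
    rw [abs_le] at h1
    rcases (abs_add_eq_add_abs_iff t u).1 (by linarith) with h3 | h3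
    · exact Or.inl ⟨h3.1, h3.2, h1.2⟩
    · exact Or.inr ⟨h3.1, h3.2, h1.1⟩
  have e1 : triangleWave ((1 - X) / 2) = X := by
    rw [triangleWave_of_abs_le (by rw [abs_le]; constructor <;> linarith),
      abs_of_nonneg (by linarith)]
    ring
  have e2 : triangleWave ((1 - Y) / 2) = Y := by
    rw [triangleWave_of_abs_le (by rw [abs_le]; constructor <;> linarith),
      abs_of_nonneg (by linarith)]
    ring
  have e3 : triangleWave ((1 - X) / 2 + (1 - Y) / 2) = Z := by
    rw [triangleWave_of_abs_le (by rw [abs_le]; constructor <;> linarith),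
      abs_of_nonneg (by linarith)]
    linarith
  obtain rfl : Z = X + Y - 1 := by linarith
  have hW : triangleWave (t + u) = triangleWave t + triangleWave u - 1 := by linarith
  rcases hcases with ⟨h1, h2, -⟩ | ⟨h1, h2, -⟩
  · refine ⟨(1 - X) / 2 + 2 * n, (1 - Y) / 2 + 2 * m, ?_, ?_, ?_, ?_, ?_, ?_⟩
    · rw [triangleWave_add_two_mul, e1]
    · rw [triangleWave_add_two_mul, e2]
    · rw [hs, triangleWave_add_two_mul, e3]
    · rw [hT, abs_of_nonneg h1]; ring
    · rw [hU, abs_of_nonneg h2]; ring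
    · rw [hW, hT, hU, abs_of_nonneg h1, abs_of_nonneg h2]; push_cast; ring
  · refine ⟨-((1 - X) / 2) + 2 * n, -((1 - Y) / 2) + 2 * m, ?_, ?_, ?_, ?_, ?_, ?_⟩
    · rw [triangleWave_add_two_mul, triangleWave_neg, e1]
    · rw [triangleWave_add_two_mul, triangleWave_neg, e2]
    · rw [hs, triangleWave_add_two_mul, ← neg_add, triangleWave_neg, e3]
    · rw [hT, abs_of_nonpos h1]; ring
    · rw [hU, abs_of_nonpos h2]; ring
    · rw [hW, hT, hU, abs_of_nonpos h1, abs_of_nonpos h2]; push_cast; ring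

/-- Points of a face lift along the folding to any lift of another point of the face, at the same
distance in each coordinate. The unit translations of the plane permute the faces, which reduces
the assertion to the last one. -/
lemma exists_lift_face {t u X Y Z : ℝ} (i : Fin 4)
    (h : vertexWeight (triangleWave t) (triangleWave u) (triangleWave (t + u)) i = 0)
    (h₀ : vertexWeight X Y Z i = 0) (hnn : ∀ j, 0 ≤ vertexWeight X Y Z j) :
    ∃ t' u', triangleWave t' = X ∧ triangleWave u' = Y ∧ triangleWave (t' + u') = Z ∧
      4 * (t - t') ^ 2 = (triangleWave t - X) ^ 2 ∧ 4 * (u - u') ^ 2 = (triangleWave u - Y) ^ 2 ∧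
      4 * (t + u - (t' + u')) ^ 2 = (triangleWave (t + u) - Z) ^ 2 := by
  have h00 := hnn 0
  have h01 := hnn 1
  have h02 := hnn 2
  have h03 := hnn 3
  have htu : triangleWave (t + 1 + u) = -triangleWave (t + u) := by
    rw [add_right_comm, triangleWave_add_one]
  have htu' : triangleWave (t + (u + 1)) = -triangleWave (t + u) := by
    rw [← add_assoc, triangleWave_add_one]
  have htu'' : triangleWave (t + 1 + (u + 1)) = triangleWave (t + u) := by
    rw [← add_assoc, triangleWave_add_one, htu, neg_neg]
  fin_cases i <;> simp only [vertexWeight, Fin.zero_eta, Fin.mk_one, Fin.reduceFinMk,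
    Matrix.cons_val] at h h₀ h00 h01 h02 h03
  · obtain ⟨t', u', h1, h2, h3, h4, h5, h6⟩ := exists_lift_last_face (t := t + 1) (u := u + 1)
      (X := -X) (Y := -Y) (Z := Z)
      (by simp only [vertexWeight, Matrix.cons_val, htu'', triangleWave_add_one]; linarith)
      (by simp only [vertexWeight, Matrix.cons_val]; linarith)
      (fun j => by fin_cases j <;> simp [vertexWeight] <;> linarith)
    rw [triangleWave_add_one] at h4 h5
    rw [htu''] at h6
    have e1 := triangleWave_add_one (t' - 1)
    have e2 := triangleWave_add_one (u' - 1)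
    have e3 := triangleWave_add_one (t' - 1 + (u' - 1))
    have e4 := triangleWave_add_one (t' - 1 + (u' - 1) + 1)
    rw [show t' - 1 + (u' - 1) + 1 + 1 = t' + u' by ring] at e4
    rw [sub_add_cancel] at e1 e2
    exact ⟨t' - 1, u' - 1, by linarith, by linarith, by linarith, by linear_combination h4,
      by linear_combination h5, by linear_combination h6⟩
  · obtain ⟨t', u', h1, h2, h3, h4, h5, h6⟩ := exists_lift_last_face (t := t + 1) (u := u)
      (X := -X) (Y := Y) (Z := -Z)
      (by simp only [vertexWeight, Matrix.cons_val, htu, triangleWave_add_one]; linarith)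
      (by simp only [vertexWeight, Matrix.cons_val]; linarith)
      (fun j => by fin_cases j <;> simp [vertexWeight] <;> linarith)
    rw [triangleWave_add_one] at h4
    rw [htu] at h6
    have e1 := triangleWave_add_one (t' - 1)
    have e3 := triangleWave_add_one (t' - 1 + u')
    rw [show t' - 1 + u' + 1 = t' + u' by ring] at e3
    rw [sub_add_cancel] at e1
    exact ⟨t' - 1, u', by linarith, h2, by linarith, by linear_combination h4, h5,
      by linear_combination h6⟩
  · obtain ⟨t', u', h1, h2, h3, h4, h5, h6⟩ := exists_lift_last_face (t := t) (u := u + 1)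
      (X := X) (Y := -Y) (Z := -Z)
      (by simp only [vertexWeight, Matrix.cons_val, htu', triangleWave_add_one]; linarith)
      (by simp only [vertexWeight, Matrix.cons_val]; linarith)
      (fun j => by fin_cases j <;> simp [vertexWeight] <;> linarith)
    rw [triangleWave_add_one] at h5
    rw [htu'] at h6
    have e2 := triangleWave_add_one (u' - 1)
    have e3 := triangleWave_add_one (t' + (u' - 1))
    rw [show t' + (u' - 1) + 1 = t' + u' by ring] at e3
    rw [sub_add_cancel] at e2
    exact ⟨t', u' - 1, h1, by linarith, by linarith, h4, by linear_combination h5,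
      by linear_combination h6⟩
  · exact exists_lift_last_face h h₀ hnn

/-! ### Box coordinates on an isosceles tetrahedron -/

namespace Tetrahedron

variable (s : Tetrahedron)

/-- The centroid of the tetrahedron. -/
def center : EuclideanSpace ℝ (Fin 3) :=
  (1 / 4 : ℝ) • (s.points 0 + s.points 1 + s.points 2 + s.points 3)

/-- The vectors from the centroid to the midpoints of the three edges at the vertex `0`. For an
isosceles tetrahedron they are the half-axes of the circumscribed box. -/
def axis : Fin 3 → EuclideanSpace ℝ (Fin 3) :=
  ![(1 / 4 : ℝ) • (s.points 0 + s.points 1 - s.points 2 - s.points 3),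
    (1 / 4 : ℝ) • (s.points 0 - s.points 1 + s.points 2 - s.points 3),
    (1 / 4 : ℝ) • (s.points 0 - s.points 1 - s.points 2 + s.points 3)]

/-- The point with coordinates `X`, `Y`, `Z` in the frame given by the centroid and the axes. -/
def box (X Y Z : ℝ) : EuclideanSpace ℝ (Fin 3) :=
  s.center + (X • s.axis 0 + Y • s.axis 1 + Z • s.axis 2)

lemma box_eq_sum (X Y Z : ℝ) :
    s.box X Y Z = ∑ j, (vertexWeight X Y Z j / 4) • s.points j := by
  simp only [box, center, axis, vertexWeight, Fin.sum_univ_four, Matrix.cons_val]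
  module

lemma sum_smul_points_eq_box (w : Fin 4 → ℝ) (hw : ∑ j, w j = 1) :
    ∑ j, w j • s.points j =
        s.box (w 0 + w 1 - w 2 - w 3) (w 0 - w 1 + w 2 - w 3) (w 0 - w 1 - w 2 + w 3) ∧
      vertexWeight (w 0 + w 1 - w 2 - w 3) (w 0 - w 1 + w 2 - w 3) (w 0 - w 1 - w 2 + w 3) =
        fun j => 4 * w j := by
  have hv : vertexWeight (w 0 + w 1 - w 2 - w 3) (w 0 - w 1 + w 2 - w 3) (w 0 - w 1 - w 2 + w 3) =
      fun j => 4 * w j := by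
    rw [Fin.sum_univ_four] at hw
    funext j
    fin_cases j <;> simp [vertexWeight] <;> linarith
  refine ⟨?_, hv⟩
  rw [box_eq_sum, hv]
  exact Finset.sum_congr rfl fun j _ => by rw [mul_div_cancel_left₀ _ (by norm_num)]

lemma mem_triangle_iff_weights (i : Fin 4) (y : EuclideanSpace ℝ (Fin 3)) :
    y ∈ s.triangle i ↔
      ∃ w : Fin 4 → ℝ, (∀ j, 0 ≤ w j) ∧ ∑ j, w j = 1 ∧ w i = 0 ∧ ∑ j, w j • s.points j = y := by
  rw [triangle, s.range_faceOpposite_points]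
  constructor
  · intro hy
    refine convexHull_min (t := {y | ∃ w : Fin 4 → ℝ, (∀ j, 0 ≤ w j) ∧ ∑ j, w j = 1 ∧ w i = 0 ∧
      ∑ j, w j • s.points j = y}) ?_ ?_ hy
    · rintro _ ⟨k, hk, rfl⟩
      refine ⟨Pi.single k 1, fun j => ?_, by simp, by simp [Ne.symm hk], by simp [Pi.single_apply]⟩
      by_cases h : j = k <;> simp [h]
    · rintro _ ⟨w, h0, h1, hi, rfl⟩ _ ⟨w', h0', h1', hi', rfl⟩ a b ha hb hab
      refine ⟨fun j => a * w j + b * w' j, fun j => ?_, ?_, by simp [hi, hi'], ?_⟩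
      · exact add_nonneg (mul_nonneg ha (h0 j)) (mul_nonneg hb (h0' j))
      · rw [Finset.sum_add_distrib, ← Finset.mul_sum, ← Finset.mul_sum, h1, h1', mul_one, mul_one,
          hab]
      · simp only [add_smul, mul_smul, Finset.sum_add_distrib, Finset.smul_sum]
  · rintro ⟨w, h0, h1, hi, rfl⟩
    have hsum : ∀ {M : Type} [AddCommMonoid M] (F : Fin 4 → M), F i = 0 →
        ∑ j ∈ Finset.univ.erase i, F j = ∑ j, F j := fun F h =>
      Finset.sum_erase _ h
    rw [← hsum _ (by rw [hi, zero_smul])]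
    refine (convex_convexHull ℝ _).sum_mem (fun j _ => h0 j) (by rw [hsum _ hi, h1]) fun j hj => ?_
    exact subset_convexHull ℝ _ ⟨j, Finset.ne_of_mem_erase hj, rfl⟩

lemma mem_triangle_iff (i : Fin 4) (y : EuclideanSpace ℝ (Fin 3)) :
    y ∈ s.triangle i ↔ ∃ X Y Z : ℝ, s.box X Y Z = y ∧ vertexWeight X Y Z i = 0 ∧
      ∀ j, 0 ≤ vertexWeight X Y Z j := by
  rw [mem_triangle_iff_weights]
  constructor
  · rintro ⟨w, h0, h1, hi, rfl⟩
    obtain ⟨hb, hv⟩ := s.sum_smul_points_eq_box w h1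
    refine ⟨_, _, _, hb.symm, ?_, fun j => ?_⟩ <;> rw [hv]
    · simp [hi]
    · have := h0 j
      positivity
  · rintro ⟨X, Y, Z, rfl, hi, hnn⟩
    refine ⟨fun j => vertexWeight X Y Z j / 4, fun j => div_nonneg (hnn j) (by norm_num), ?_,
      (div_eq_zero_iff.2 (Or.inl hi)), (s.box_eq_sum X Y Z).symm⟩
    simp only [Fin.sum_univ_four, vertexWeight, Matrix.cons_val]
    ring

lemma axis_ne_zero (k : Fin 3) : s.axis k ≠ 0 := by
  have h := (affineIndependent_iff (ι := Fin 4)).1 s.independent Finset.univ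
  intro hk
  fin_cases k <;> simp only [axis, Fin.zero_eta, Fin.mk_one, Fin.reduceFinMk, Matrix.cons_val,
    smul_eq_zero, one_div, inv_eq_zero, OfNat.ofNat_ne_zero, false_or] at hk
  · have := h ![1, 1, -1, -1] (by simp [Fin.sum_univ_four])
      (by simp only [Fin.sum_univ_four, Matrix.cons_val]; rw [← hk]; module) 0 (Finset.mem_univ _)
    simp at this
  · have := h ![1, -1, 1, -1] (by simp [Fin.sum_univ_four])
      (by simp only [Fin.sum_univ_four, Matrix.cons_val]; rw [← hk]; module) 0 (Finset.mem_univ _)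
    simp at this
  · have := h ![1, -1, -1, 1] (by simp [Fin.sum_univ_four])
      (by simp only [Fin.sum_univ_four, Matrix.cons_val]; rw [← hk]; module) 0 (Finset.mem_univ _)
    simp at this

variable {s}

/-- The perimeter of the face opposite to the vertex `i`: half the sum over all ordered pairs of its
vertices. -/
def perimeter (s : Tetrahedron) (i : Fin 4) : ℝ :=
  ∑ j : Fin 3, ∑ k : Fin 3, dist (s.points (i.succAbove j)) (s.points (i.succAbove k)) / 2

lemma IsIsosceles.perimeter_eq (hs : s.IsIsosceles) (i j : Fin 4) :
    s.perimeter i = s.perimeter j := by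
  obtain ⟨σ, hσ⟩ := hs i j
  have h : ∀ a b, dist (s.points (j.succAbove a)) (s.points (j.succAbove b)) =
      dist (s.points (i.succAbove (σ a))) (s.points (i.succAbove (σ b))) := fun a b => by
    have := hσ.dist_eq a b
    simp only [Function.comp_apply, s.faceOpposite_point_eq_point_succAbove] at this
    exact this.symm
  unfold perimeter
  simp only [h]
  rw [← Equiv.sum_comp σ]
  exact Finset.sum_congr rfl fun a _ => (Equiv.sum_comp σ _).symm

/-- Equality of the perimeters of the faces already makes opposite edges equal. -/
lemma IsIsosceles.dist_opposite (hs : s.IsIsosceles) :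
    dist (s.points 0) (s.points 1) = dist (s.points 2) (s.points 3) ∧
    dist (s.points 0) (s.points 2) = dist (s.points 1) (s.points 3) ∧
    dist (s.points 0) (s.points 3) = dist (s.points 1) (s.points 2) := by
  have h0 := hs.perimeter_eq 0 1
  have h1 := hs.perimeter_eq 0 2
  have h2 := hs.perimeter_eq 0 3
  have e0 : ∀ i : Fin 4, s.perimeter i =
      dist (s.points (i.succAbove 0)) (s.points (i.succAbove 1)) +
      dist (s.points (i.succAbove 0)) (s.points (i.succAbove 2)) +
      dist (s.points (i.succAbove 1)) (s.points (i.succAbove 2)) := fun i => by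
    simp only [perimeter, Fin.sum_univ_three, dist_self]
    rw [dist_comm (s.points (i.succAbove 1)) (s.points (i.succAbove 0)),
      dist_comm (s.points (i.succAbove 2)) (s.points (i.succAbove 0)),
      dist_comm (s.points (i.succAbove 2)) (s.points (i.succAbove 1))]
    ring
  rw [e0, e0] at h0 h1 h2
  change dist (s.points 1) (s.points 2) + dist (s.points 1) (s.points 3) +
    dist (s.points 2) (s.points 3) = dist (s.points 0) (s.points 2) +
    dist (s.points 0) (s.points 3) + dist (s.points 2) (s.points 3) at h0
  change dist (s.points 1) (s.points 2) + dist (s.points 1) (s.points 3) +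
    dist (s.points 2) (s.points 3) = dist (s.points 0) (s.points 1) +
    dist (s.points 0) (s.points 3) + dist (s.points 1) (s.points 3) at h1
  change dist (s.points 1) (s.points 2) + dist (s.points 1) (s.points 3) +
    dist (s.points 2) (s.points 3) = dist (s.points 0) (s.points 1) +
    dist (s.points 0) (s.points 2) + dist (s.points 1) (s.points 2) at h2
  refine ⟨?_, ?_, ?_⟩ <;> linarith

/-- Opposite edges have equal lengths exactly when the parallelograms spanned by the axes are
rectangles. -/
lemma IsIsosceles.inner_axis (hs : s.IsIsosceles) :
    inner ℝ (s.axis 0) (s.axis 1) = 0 ∧ inner ℝ (s.axis 0) (s.axis 2) = 0 ∧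
      inner ℝ (s.axis 1) (s.axis 2) = 0 := by
  obtain ⟨h1, h2, h3⟩ := hs.dist_opposite
  rw [dist_eq_norm, dist_eq_norm] at h1 h2 h3
  have key : ∀ {x y : EuclideanSpace ℝ (Fin 3)} {p q r t : EuclideanSpace ℝ (Fin 3)},
      ‖p - q‖ = ‖r - t‖ → (2 : ℝ) • (x + y) = p - q →
      (2 : ℝ) • (x - y) = r - t → inner ℝ x y = 0 := by
    intro x y p q r t h ha hb
    rw [← hb, ← ha, norm_smul, norm_smul] at h
    have h' := mul_left_cancel₀ (norm_ne_zero_iff.2 (two_ne_zero (α := ℝ))) h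
    linarith [norm_add_sq_real x y, norm_sub_sq_real x y, congrArg (· ^ 2) h']
  refine ⟨key h3 ?_ ?_, key h2 ?_ ?_, key h1 ?_ ?_⟩ <;>
    simp only [axis, Matrix.cons_val] <;> module

lemma IsIsosceles.dist_box_sq (hs : s.IsIsosceles) (X Y Z X' Y' Z' : ℝ) :
    dist (s.box X Y Z) (s.box X' Y' Z') ^ 2 =
      ‖s.axis 0‖ ^ 2 * (X - X') ^ 2 + ‖s.axis 1‖ ^ 2 * (Y - Y') ^ 2 +
        ‖s.axis 2‖ ^ 2 * (Z - Z') ^ 2 := by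
  obtain ⟨h1, h2, h3⟩ := hs.inner_axis
  have e : s.box X Y Z - s.box X' Y' Z' =
      (X - X') • s.axis 0 + (Y - Y') • s.axis 1 + (Z - Z') • s.axis 2 := by
    simp only [box]
    module
  rw [dist_eq_norm, e, norm_add_sq_real, norm_add_sq_real]
  simp only [inner_add_left, real_inner_smul_left, real_inner_smul_right, h1, h2, h3, norm_smul,
    mul_pow, Real.norm_eq_abs, sq_abs]
  ring

lemma IsIsosceles.box_injective (hs : s.IsIsosceles) {X Y Z X' Y' Z' : ℝ}
    (h : s.box X Y Z = s.box X' Y' Z') : X = X' ∧ Y = Y' ∧ Z = Z' := by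
  have hd := hs.dist_box_sq X Y Z X' Y' Z'
  rw [h, dist_self] at hd
  have h0 := norm_pos_iff.2 (s.axis_ne_zero 0)
  have h1 := norm_pos_iff.2 (s.axis_ne_zero 1)
  have h2 := norm_pos_iff.2 (s.axis_ne_zero 2)
  have n0 : 0 ≤ ‖s.axis 0‖ ^ 2 * (X - X') ^ 2 := by positivity
  have n1 : 0 ≤ ‖s.axis 1‖ ^ 2 * (Y - Y') ^ 2 := by positivity
  have n2 : 0 ≤ ‖s.axis 2‖ ^ 2 * (Z - Z') ^ 2 := by positivity
  have key : ∀ {a x y : ℝ}, 0 < a → a ^ 2 * (x - y) ^ 2 = 0 → x = y := fun ha h =>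
    sub_eq_zero.1 (pow_eq_zero_iff two_ne_zero |>.1
      ((mul_eq_zero.1 h).resolve_left (pow_pos ha 2).ne'))
  exact ⟨key h0 (by linarith), key h1 (by linarith), key h2 (by linarith)⟩

end Tetrahedron

/-! ### The folding of the plane onto the surface -/

/-- The Euclidean plane has linear coordinates `t`, `u` in which the square of the norm is
`4 (a² t² + b² u² + c² (t + u)²)`. -/
lemma exists_plane_coordinates {a b c : ℝ} (ha : 0 < a) (hb : 0 < b) (hc : 0 < c) :
    ∃ t u : EuclideanSpace ℝ (Fin 2) →L[ℝ] ℝ,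
      (∀ x, ‖x‖ ^ 2 = 4 * (a ^ 2 * t x ^ 2 + b ^ 2 * u x ^ 2 + c ^ 2 * (t x + u x) ^ 2)) ∧
      ∀ α β : ℝ, ∃ x, t x = α ∧ u x = β := by
  -- The form is `4 (A (t + (c² / A) u)² + D u²)`.
  set A := a ^ 2 + c ^ 2 with hA
  have hA0 : 0 < A := by positivity
  set D := b ^ 2 + a ^ 2 * c ^ 2 / A with hD
  have hD0 : 0 < D := by positivity
  have hsA : √A ≠ 0 := (Real.sqrt_pos.2 hA0).ne'
  have hsD : √D ≠ 0 := (Real.sqrt_pos.2 hD0).ne'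
  have hsA2 : √A ^ 2 = A := Real.sq_sqrt hA0.le
  have hsD2 : √D ^ 2 = D := Real.sq_sqrt hD0.le
  let u : EuclideanSpace ℝ (Fin 2) →L[ℝ] ℝ := (1 / (2 * √D)) • EuclideanSpace.proj 1
  let t : EuclideanSpace ℝ (Fin 2) →L[ℝ] ℝ :=
    (1 / (2 * √A)) • EuclideanSpace.proj 0 - (c ^ 2 / A) • u
  have hu : ∀ x, u x = 1 / (2 * √D) * x 1 := fun x => rfl
  have ht : ∀ x, t x = 1 / (2 * √A) * x 0 - c ^ 2 / A * u x := fun x => rfl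
  refine ⟨t, u, fun x => ?_, fun α β => ?_⟩
  · have h1 : x 1 = 2 * √D * u x := by rw [hu]; field_simp
    have h0 : x 0 = 2 * √A * (t x + c ^ 2 / A * u x) := by rw [ht]; field_simp; ring
    rw [EuclideanSpace.norm_sq_eq, Fin.sum_univ_two, Real.norm_eq_abs, Real.norm_eq_abs, sq_abs,
      sq_abs, h0, h1, mul_pow, mul_pow, mul_pow, mul_pow, hsA2, hsD2, hD]
    field_simp
    rw [hA]
    ring
  · refine ⟨!₂[2 * √A * (α + c ^ 2 / A * β), 2 * √D * β], ?_, ?_⟩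
    · rw [ht, hu]
      simp
      field_simp
      ring
    · rw [hu]
      simp
      field_simp

namespace Tetrahedron

/-- A folding of the plane onto the surface of an isosceles tetrahedron: it does not increase
intrinsic distances, lifts them, and preserves them near some point. -/
theorem IsIsosceles.exists_folding {s : Tetrahedron} (hs : s.IsIsosceles) :
    ∃ q : EuclideanSpace ℝ (Fin 2) → s.Surface,
      (∀ x y, dist (q x) (q y) ≤ dist x y) ∧
      (∀ y x, ∃ y', q y' = x ∧ dist y y' ≤ dist (q y) x) ∧
      ∃ x₀, ∃ ε > 0, ∀ x y, dist x x₀ < ε → dist y x₀ < ε → dist (q x) (q y) = dist x y := by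
  obtain ⟨t, u, hnorm, hsurj⟩ := exists_plane_coordinates (norm_pos_iff.2 (s.axis_ne_zero 0))
    (norm_pos_iff.2 (s.axis_ne_zero 1)) (norm_pos_iff.2 (s.axis_ne_zero 2))
  have hdist : ∀ x y, dist x y ^ 2 = ‖s.axis 0‖ ^ 2 * (4 * (t x - t y) ^ 2) +
      ‖s.axis 1‖ ^ 2 * (4 * (u x - u y) ^ 2) +
      ‖s.axis 2‖ ^ 2 * (4 * (t x + u x - (t y + u y)) ^ 2) := fun x y => by
    rw [dist_eq_norm, hnorm, map_sub, map_sub]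
    ring
  let P : EuclideanSpace ℝ (Fin 2) → EuclideanSpace ℝ (Fin 3) := fun x =>
    s.box (triangleWave (t x)) (triangleWave (u x)) (triangleWave (t x + u x))
  have hPtri : ∀ x, ∃ i, P x ∈ s.triangle i := fun x => by
    obtain ⟨i, h0, hnn⟩ := exists_vertexWeight_triangleWave_eq_zero (t x) (u x)
    exact ⟨i, (s.mem_triangle_iff i _).2 ⟨_, _, _, rfl, h0, hnn⟩⟩
  let p : EuclideanSpace ℝ (Fin 2) → s.surface := fun x => ⟨P x, Set.mem_iUnion.2 (hPtri x)⟩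
  have hsq : ∀ α β : ℝ, (triangleWave α - triangleWave β) ^ 2 ≤ 4 * (α - β) ^ 2 := fun α β => by
    rw [← sq_abs, ← sq_abs (α - β)]
    nlinarith [abs_triangleWave_sub_le α β, abs_nonneg (triangleWave α - triangleWave β),
      abs_nonneg (α - β)]
  have hp : LipschitzWith 1 p := by
    refine LipschitzWith.of_dist_le_mul fun x y => ?_
    rw [NNReal.coe_one, one_mul]
    refine le_of_sq_le_sq ?_ dist_nonneg
    change dist (P x) (P y) ^ 2 ≤ _
    rw [hs.dist_box_sq, hdist]
    gcongr <;> exact hsq _ _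
  have hC : ∀ i, IsClosed {z : s.surface | (z : EuclideanSpace ℝ (Fin 3)) ∈ s.triangle i} :=
    fun i => ((Set.finite_range _).isClosed_convexHull ℝ).preimage continuous_subtype_val
  have hcover : ∀ z : s.surface, ∃ i, z ∈
      {z : s.surface | (z : EuclideanSpace ℝ (Fin 3)) ∈ s.triangle i} :=
    fun z => by
      obtain ⟨i, hi⟩ := Set.mem_iUnion.1 z.2
      exact ⟨i, hi⟩
  have hface : ∀ i y (x : s.surface), P y ∈ s.triangle i →
      (x : EuclideanSpace ℝ (Fin 3)) ∈ s.triangle i →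
      ∃ y', p y' = x ∧ dist y y' ≤ dist (p y) x := by
    rintro i y ⟨x, hx'⟩ hy hx
    obtain ⟨X', Y', Z', he, hi', -⟩ := (s.mem_triangle_iff i _).1 hy
    obtain ⟨rfl, rfl, rfl⟩ := hs.box_injective he
    obtain ⟨X, Y, Z, rfl, hi, hnn⟩ := (s.mem_triangle_iff i x).1 hx
    obtain ⟨α, β, h1, h2, h3, h4, h5, h6⟩ := exists_lift_face i hi' hi hnn
    obtain ⟨y', rfl, rfl⟩ := hsurj α β
    refine ⟨y', Subtype.ext ?_, le_of_sq_le_sq ?_ dist_nonneg⟩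
    · change s.box _ _ _ = _
      rw [h1, h2, h3]
    · change _ ≤ dist (P y) _ ^ 2
      rw [hs.dist_box_sq, hdist, h4, h5, h6]
  have hpsurj : Function.Surjective p := by
    intro x
    obtain ⟨i, hi⟩ := hcover x
    obtain ⟨y, hy⟩ : ∃ y, P y ∈ s.triangle i := by
      obtain ⟨α, β, h⟩ := exists_vertexWeight_triangleWave_eq_zero_of_face i
      obtain ⟨y, rfl, rfl⟩ := hsurj α β
      exact ⟨y, (s.mem_triangle_iff i _).2 ⟨_, _, _, rfl, h.1, h.2⟩⟩
    obtain ⟨y', hy', -⟩ := hface i y x hy hi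
    exact ⟨y', hy'⟩
  have hdist_le : ∀ x y, intrinsicEDist (p x) (p y) ≤ ENNReal.ofReal (dist x y) :=
    intrinsicEDist_le_of_lipschitzWith hp
  have hle : ∀ x y, dist (⟨p x⟩ : s.Surface) ⟨p y⟩ ≤ dist x y := fun x y =>
    ENNReal.toReal_le_of_le_ofReal dist_nonneg (hdist_le x y)
  refine ⟨fun x => ⟨p x⟩, hle, ?_, ?_⟩
  · rintro y ⟨x⟩
    obtain ⟨y', rfl, h⟩ := exists_lift_of_lift_on_closed_cover hC hcover hp.continuous hpsurj
      hface y x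
    exact ⟨y', rfl, (ENNReal.ofReal_le_iff_le_toReal (s.intrinsicEDist_ne_top _ _)).1 h⟩
  · obtain ⟨x₀, h1, h2⟩ := hsurj (1 / 4) (1 / 4)
    have hnhds : ∀ᶠ x in nhds x₀, 0 ≤ t x ∧ 0 ≤ u x ∧ t x + u x ≤ 1 := by
      have e1 := t.continuous.continuousAt.eventually_const_lt
        (show (0 : ℝ) < t x₀ by rw [h1]; norm_num)
      have e2 := u.continuous.continuousAt.eventually_const_lt
        (show (0 : ℝ) < u x₀ by rw [h2]; norm_num)
      have e3 := (t.continuous.add u.continuous).continuousAt.eventually_lt_const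
        (show t x₀ + u x₀ < (1 : ℝ) by rw [h1, h2]; norm_num)
      filter_upwards [e1, e2, e3] with x h1 h2 h3
      exact ⟨h1.le, h2.le, h3.le⟩
    obtain ⟨ε, hε, hball⟩ := Metric.eventually_nhds_iff.1 hnhds
    refine ⟨x₀, ε, hε, fun x y hx hy => le_antisymm (hle x y) ?_⟩
    have hwave : ∀ α : ℝ, 0 ≤ α → α ≤ 1 → triangleWave α = 1 - 2 * α := fun α h0 h1 => by
      rw [triangleWave_of_abs_le (by rwa [abs_of_nonneg h0]), abs_of_nonneg h0]
    obtain ⟨a1, a2, a3⟩ := hball hx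
    obtain ⟨b1, b2, b3⟩ := hball hy
    have heq : dist (p x) (p y) = dist x y := by
      refine (sq_eq_sq₀ dist_nonneg dist_nonneg).1 ?_
      change dist (P x) (P y) ^ 2 = _
      rw [hs.dist_box_sq, hdist, hwave _ a1 (by linarith), hwave _ a2 (by linarith),
        hwave _ (by linarith) a3, hwave _ b1 (by linarith), hwave _ b2 (by linarith),
        hwave _ (by linarith) b3]
      ring
    rw [← heq]
    refine (ENNReal.ofReal_le_iff_le_toReal (s.intrinsicEDist_ne_top _ _)).1 ?_
    rw [← edist_dist]
    exact edist_le_intrinsicEDist _ _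

end Tetrahedron

end

/-! ### The Steiner ratio of the surface -/

theorem mainTheorem3 (s : Tetrahedron) (hs : s.IsIsosceles) :
    steinerRatio s.Surface = steinerRatio (EuclideanSpace ℝ (Fin 2)) := by
  obtain ⟨q, hq, hlift, x₀, ε, hε, hiso⟩ := hs.exists_folding
  refine le_antisymm (steinerRatio_le_of_similar_copies fun N => ?_) ?_
  · -- A small copy of `N` near `x₀` is folded isometrically.
    obtain ⟨R, hR, hN⟩ : ∃ R > 0, ∀ x ∈ N, ‖x‖ ≤ R := by
      obtain ⟨R, hR⟩ := N.finite_toSet.isBounded.exists_pos_norm_le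
      exact ⟨R, hR.1, fun x hx => hR.2 x hx⟩
    have hr : 0 < ε / (2 * R) := by positivity
    have hnear : ∀ x ∈ N, dist (x₀ + (ε / (2 * R)) • x) x₀ < ε := fun x hx => by
      rw [dist_self_add_left, norm_smul, Real.norm_of_nonneg hr.le]
      calc ε / (2 * R) * ‖x‖ ≤ ε / (2 * R) * R := by gcongr; exact hN x hx
        _ = ε / 2 := by field_simp
        _ < ε := half_lt_self hε
    refine ⟨fun x => q (x₀ + (ε / (2 * R)) • x), ε / (2 * R), hr, fun x hx y hy => ?_⟩
    rw [hiso _ _ (hnear x hx) (hnear y hy), dist_add_left, dist_smul₀, Real.norm_of_nonneg hr.le]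
  · have : Nontrivial s.Surface := by
      obtain ⟨v, hv⟩ := exists_norm_eq (EuclideanSpace ℝ (Fin 2)) (half_pos hε).le
      refine ⟨q (x₀ + v), q x₀, dist_pos.1 ?_⟩
      rw [hiso _ _ (by rw [dist_self_add_left, hv]; exact half_lt_self hε) (by rwa [dist_self]),
        dist_self_add_left, hv]
      exact half_pos hε
    exact steinerRatio_le_of_submetry q hq hlift
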